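/- Let $k$ be a commutative artinian ring, let $n\ge 1$, and let $(\mathcal C,\mathbb E,\mathfrak s)$ be a $k$-linear $n$-exangulated category (in the sense of Herschend–Liu–Nakaoka, with $\mathbb E\colon\mathcal C^{\mathrm{op}}\times\mathcal C\to \mathrm{Mod}\,k$ being $k$-bilinear) such that: * $\mathcal C$ is $\mathrm{Ext}$-finite: every $\mathbb E(X,Y)$ is a finitely generated $k$-module; * $\mathcal C$ is Krull–Schmidt: every object is a finite direct sum of objects with local endomorphism rings; * for all composable morphisms $f\colon X\to Y$, $g\colon Y\to Z$: if $g\circ f$ is a deflation then so is $g$, and if $g\circ f$ is an inflation then so is $f$. Here an inflation (resp. deflation) is the first (resp. last) differential of a complex $X_0\to X_1\to\cdots\to X_{n+1}$ realizing some extension. For objects $A,B$ let $\mathcal P(A,B)$ be the set of $f\in\mathcal C(A,B)$ with $\mathbb E(f,Z)=0$ for all $Z\in\mathcal C$, and let $\mathcal I(A,B)$ be the set of $g\in\mathcal C(A,B)$ with $\mathbb E(Z,g)=0$ for all $Z\in\mathcal C$. Let $\overline{\mathcal C}$ be the category with the same objects as $\mathcal C$ and $\overline{\mathcal C}(A,B)=\mathcal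 C(A,B)/\mathcal I(A,B)$. Let $\check k$ be the minimal injective cogenerator of the category of finitely generated $k$-modules, and put $D=\mathrm{Hom}_k(-,\check k)$. Let $\mathcal C_r$ be the class of objects $X$ such that the contravariant functor $D\mathbb E(X,-)$ from $\overline{\mathcal C}$ to $k$-modules is representable, i.e. isomorphic to $\overline{\mathcal C}(-,Z)$ for some object $Z$. A morphism $f\colon X\to Y$ is right $C$-determined if each $g\colon L\to Y$ such that $g\circ h$ factors through $f$ for every $h\colon C\to L$ itself factors through $f$. Let $C\in\mathcal C$. Suppose that for each $X_{n+1}\in\mathcal C$ and each right $\mathrm{End}_{\mathcal C}(C)$-submodule $H$ of $\mathcal C(C,X_{n+1})$ with $\mathcal P(C,X_{n+1})\subseteq H$ there exists a right $C$-determined deflation $\alpha\colon X_n\to X_{n+1}$ such that $\mathrm{Im}\,\mathcal C(C,\alpha)=H$. Then $C\in\mathcal C_r$. -/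

import Mathlib

open CategoryTheory CategoryTheory.Limits Opposite

open scoped ZeroObject

universe w v u uk

noncomputable section

namespace HigherExact

/-! ### Injective cogenerators of the category of finitely generated modules -/

/-- `I` is an injective cogenerator of the category `k-mod` of finitely generated `k`-modules. -/
structure IsInjectiveCogenerator (k : Type uk) [CommRing k]
    (I : Type uk) [AddCommGroup I] [Module k I] : Prop where
  finite : Module.Finite k I
  injective : ∀ (M N : Type uk) [AddCommGroup M] [Module k M] [AddCommGroup N] [Module k N]
    [Module.Finite k M] [Module.Finite k N] (i : M →ₗ[k] N) (f : M →ₗ[k] I),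
    Function.Injective i → ∃ g : N →ₗ[k] I, g ∘ₗ i = f
  cogenerates : ∀ (M : Type uk) [AddCommGroup M] [Module k M] [Module.Finite k M] (x : M),
    x ≠ 0 → ∃ f : M →ₗ[k] I, f x ≠ 0

/-- `I` is a minimal injective cogenerator of `k-mod`: no proper submodule of it is again an
injective cogenerator.  For a commutative artinian ring `k` this determines `I` up to isomorphism
(it is the injective envelope of `k / rad k`). -/
structure IsMinimalInjectiveCogenerator (k : Type uk) [CommRing k]
    (I : Type uk) [AddCommGroup I] [Module k I] : Prop
    extends IsInjectiveCogenerator k I where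
  minimal : ∀ Q : Submodule k I, IsInjectiveCogenerator k Q → Q = ⊤

/-! ### Bifunctors of extensions -/

/-- A `k`-bilinear bifunctor `𝔼 : Cᵒᵖ × C → Mod k`. -/
structure ExtBifunctor (k : Type uk) [CommRing k] (C : Type u) [Category.{v} C] [Preadditive C]
    [Linear k C] where
  functor : Cᵒᵖ ⥤ C ⥤ ModuleCat.{w} k
  map_add_right : ∀ (B : C) {A A' : C} (a a' : A ⟶ A'),
    (functor.obj (op B)).map (a + a') = (functor.obj (op B)).map a + (functor.obj (op B)).map a'
  map_smul_right : ∀ (B : C) {A A' : C} (r : k) (a : A ⟶ A'),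
    (functor.obj (op B)).map (r • a) = r • (functor.obj (op B)).map a
  map_add_left : ∀ (A : C) {B B' : C} (b b' : B' ⟶ B),
    (functor.map (b + b').op).app A = (functor.map b.op).app A + (functor.map b'.op).app A
  map_smul_left : ∀ (A : C) {B B' : C} (r : k) (b : B' ⟶ B),
    (functor.map (r • b).op).app A = r • (functor.map b.op).app A

section

variable {k : Type uk} [CommRing k] {C : Type u} [Category.{v} C] [Preadditive C] [Linear k C]

namespace ExtBifunctor

variable (𝔼 : ExtBifunctor.{w} k C)

/-- The `k`-module `𝔼(B, A)` of extensions. -/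
abbrev Ext (B A : C) : Type w := (𝔼.functor.obj (op B)).obj A

/-- The push-forward `a_* = 𝔼(B, a) : 𝔼(B, A) → 𝔼(B, A')`. -/
def push {B A A' : C} (a : A ⟶ A') : 𝔼.Ext B A →ₗ[k] 𝔼.Ext B A' :=
  ((𝔼.functor.obj (op B)).map a).hom

/-- The pull-back `b^* = 𝔼(b, A) : 𝔼(B, A) → 𝔼(B', A)`. -/
def pull {B B' A : C} (b : B' ⟶ B) : 𝔼.Ext B A →ₗ[k] 𝔼.Ext B' A :=
  ((𝔼.functor.map b.op).app A).hom

lemma push_comp {B A A' A'' : C} (a : A ⟶ A') (a' : A' ⟶ A'') (δ : 𝔼.Ext B A) :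
    𝔼.push (a ≫ a') δ = 𝔼.push a' (𝔼.push a δ) := by
  simp [push]

lemma push_id {B A : C} (δ : 𝔼.Ext B A) : 𝔼.push (𝟙 A) δ = δ := by
  simp [push]

lemma push_sub {B A A' : C} (a a' : A ⟶ A') (δ : 𝔼.Ext B A) :
    𝔼.push (a - a') δ = 𝔼.push a δ - 𝔼.push a' δ := by
  rw [eq_sub_iff_add_eq]
  have h := 𝔼.map_add_right B (a - a') a'
  rw [sub_add_cancel] at h
  simp [push, h]

lemma push_smul {B A A' : C} (r : k) (a : A ⟶ A') (δ : 𝔼.Ext B A) :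
    𝔼.push (r • a) δ = r • 𝔼.push a δ := by
  simp [push, 𝔼.map_smul_right]

lemma push_pull {B B' A A' : C} (b : B' ⟶ B) (a : A ⟶ A') (δ : 𝔼.Ext B A) :
    𝔼.push a (𝔼.pull b δ) = 𝔼.pull b (𝔼.push a δ) := by
  have h := (𝔼.functor.map b.op).naturality a
  exact (LinearMap.congr_fun (congrArg ModuleCat.Hom.hom h) δ).symm

/-- A morphism `f` is `n`-projectively trivial if `𝔼(f, Z) = 0` for all `Z`. -/
def ProjTrivial {X Y : C} (f : X ⟶ Y) : Prop :=
  ∀ (Z : C) (δ : 𝔼.Ext Y Z), 𝔼.pull f δ = 0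

/-- A morphism `g` is `n`-injectively trivial if `𝔼(Z, g) = 0` for all `Z`. -/
def InjTrivial {X Y : C} (g : X ⟶ Y) : Prop :=
  ∀ (Z : C) (δ : 𝔼.Ext Z X), 𝔼.push g δ = 0

/-- Two morphisms are identified in the costable category when their difference is
`n`-injectively trivial. -/
def costableRel : HomRel C := fun _ _ f g => 𝔼.InjTrivial (f - g)

lemma costableRel_iff {X Y : C} (f g : X ⟶ Y) :
    𝔼.costableRel f g ↔ ∀ (Z : C) (δ : 𝔼.Ext Z X), 𝔼.push f δ = 𝔼.push g δ := by
  simp only [costableRel, InjTrivial, push_sub, sub_eq_zero]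

instance : Congruence 𝔼.costableRel where
  comp_left f _ _ h := by
    rw [costableRel_iff] at h ⊢
    intro Z δ
    rw [push_comp, push_comp, h]
  comp_right g h := by
    rw [costableRel_iff] at h ⊢
    intro Z δ
    rw [push_comp, push_comp, h]
  equivalence := by
    refine ⟨fun f => ?_, fun {f g} h => ?_, fun {f g h} h₁ h₂ => ?_⟩
    · rw [costableRel_iff]; intro Z δ; rfl
    · rw [costableRel_iff] at h ⊢; intro Z δ; rw [h]
    · rw [costableRel_iff] at h₁ h₂ ⊢; intro Z δ; rw [h₁, h₂]

/-- The costable category `C̄`: same objects, morphisms `C(A, B) / I(A, B)`, where `I(A, B)` is the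
set of `n`-injectively trivial morphisms. -/
abbrev Costable : Type u := Quotient 𝔼.costableRel

lemma costableRel_add ⦃X Y : C⦄ (f₁ f₂ g₁ g₂ : X ⟶ Y) (hf : 𝔼.costableRel f₁ f₂)
    (hg : 𝔼.costableRel g₁ g₂) : 𝔼.costableRel (f₁ + g₁) (f₂ + g₂) := by
  intro Z δ
  have h : f₁ + g₁ - (f₂ + g₂) = (f₁ - f₂) - (g₂ - g₁) := by abel
  have h' : g₂ - g₁ = (0 : X ⟶ Y) - (g₁ - g₂) := by abel
  have h0 : 𝔼.push (0 : X ⟶ Y) δ = 0 := by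
    have := 𝔼.push_sub (0 : X ⟶ Y) 0 δ
    simpa using this
  rw [h, push_sub, hf Z δ, h', push_sub, hg Z δ, h0]
  simp

lemma costableRel_smul (r : k) ⦃X Y : C⦄ (f₁ f₂ : X ⟶ Y) (hf : 𝔼.costableRel f₁ f₂) :
    𝔼.costableRel (r • f₁) (r • f₂) := by
  intro Z δ
  rw [← smul_sub, push_smul, hf Z δ, smul_zero]

instance : Preadditive 𝔼.Costable := Quotient.preadditive _ 𝔼.costableRel_add

instance : (Quotient.functor 𝔼.costableRel).Additive :=
  Quotient.functor_additive _ 𝔼.costableRel_add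

instance : Linear k 𝔼.Costable := Quotient.linear k _ 𝔼.costableRel_smul

variable (I : Type uk) [AddCommGroup I] [Module k I]

/-- The functor `Y ↦ D𝔼(X, Y) = Hom_k(𝔼(X, Y), I)` on `C`, contravariant in `Y`, with values in
`(Mod k)ᵒᵖ` so as to be written covariantly. -/
def dualExtAux (X : C) : C ⥤ (ModuleCat.{max w uk} k)ᵒᵖ where
  obj Y := op (ModuleCat.of k (𝔼.Ext X Y →ₗ[k] I))
  map g := (ModuleCat.ofHom (LinearMap.lcomp k I (𝔼.push (B := X) g))).op
  map_id Y := by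
    apply Quiver.Hom.unop_inj
    ext φ δ
    exact congrArg φ (𝔼.push_id δ)
  map_comp f g := by
    apply Quiver.Hom.unop_inj
    ext φ δ
    exact congrArg φ (𝔼.push_comp f g δ)

/-- The contravariant functor `D𝔼(X, -) : C̄ → Mod k`, where `D = Hom_k(-, I)`. -/
def dualExt (X : C) : 𝔼.Costableᵒᵖ ⥤ ModuleCat.{max w uk} k :=
  (CategoryTheory.Quotient.lift 𝔼.costableRel (𝔼.dualExtAux I X) (by
    intro Y Y' f g h
    rw [costableRel_iff] at h
    apply Quiver.Hom.unop_inj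
    ext φ
    apply LinearMap.ext
    intro δ
    exact congrArg (DFunLike.coe (F := 𝔼.Ext X Y' →ₗ[k] I) φ) (h X δ))).leftOp

end ExtBifunctor

/-- A contravariant functor `F` from a `k`-linear category to `k`-modules is representable: it is
isomorphic, as a functor to `k`-modules, to `D(-, Z)` for some object `Z`. -/
def IsLinearRepresentable {D : Type*} [Category* D] [Preadditive D] [Linear k D]
    (F : Dᵒᵖ ⥤ ModuleCat.{w} k) : Prop :=
  ∃ (Z : D) (e : ∀ Y : D, (Y ⟶ Z) ≃ₗ[k] F.obj (op Y)),
    ∀ ⦃Y Y' : D⦄ (f : Y' ⟶ Y) (g : Y ⟶ Z), e Y' (f ≫ g) = (F.map f.op).hom (e Y g)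

/-! ### Complexes of length `n + 2` -/

/-- A complex `X₀ → X₁ → ⋯ → Xₙ → Xₙ₊₁` (zero outside of the degrees `0, …, n + 1`), together with
identifications of `X₀` with `A` and of `Xₙ₊₁` with `B`. -/
structure NComplex (n : ℕ) (A B : C) where
  K : CochainComplex C ℕ
  isZero : ∀ i, n + 1 < i → IsZero (K.X i)
  left : K.X 0 ≅ A
  right : K.X (n + 1) ≅ B

namespace NComplex

variable {n : ℕ} {A B A' B' : C}

/-- The first differential `A → X₁`. -/
def dFirst (X : NComplex n A B) : A ⟶ X.K.X 1 := X.left.inv ≫ X.K.d 0 1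

/-- The last differential `Xₙ → B`. -/
def dLast (X : NComplex n A B) : X.K.X n ⟶ B := X.K.d n (n + 1) ≫ X.right.hom

/-- A morphism of complexes is of the form `(a, f₁, …, fₙ, b)`. -/
structure HasEnds {X : NComplex n A B} {Y : NComplex n A' B'} (f : X.K ⟶ Y.K)
    (a : A ⟶ A') (b : B ⟶ B') : Prop where
  left : f.f 0 ≫ Y.left.hom = X.left.hom ≫ a
  right : f.f (n + 1) ≫ Y.right.hom = X.right.hom ≫ b

/-- Two complexes with the same end terms `A` and `B` are homotopy equivalent by morphisms of the
form `(id_A, f₁, …, fₙ, id_B)`. -/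
def HomotopyEquivalent (X Y : NComplex n A B) : Prop :=
  ∃ h : HomotopyEquiv X.K Y.K,
    HasEnds (X := X) (Y := Y) h.hom (𝟙 A) (𝟙 B) ∧ HasEnds (X := Y) (Y := X) h.inv (𝟙 A) (𝟙 B)

/-- `M` is (isomorphic to) the mapping cone
`X₁ → X₂ ⊕ Y₁ → X₃ ⊕ Y₂ → ⋯ → Xₙ₊₁ ⊕ Yₙ → Yₙ₊₁` of `f : X ⟶ Y`, whose differentials have the
components `-d : Xᵢ₊₁ → Xᵢ₊₂`, `f : Xᵢ₊₁ → Yᵢ₊₁` and `d : Yᵢ → Yᵢ₊₁`.  Here `p j` and `q j` are the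
projections of the term of degree `j` to `Xⱼ₊₁` and `Yⱼ`; the terms of degree `1, …, n` are (bi)products. -/
structure MappingCone {D : C} {X : NComplex n A B} {Y : NComplex n A' D}
    (f : X.K ⟶ Y.K) (M : NComplex n (X.K.X 1) D) where
  p : ∀ j, M.K.X j ⟶ X.K.X (j + 1)
  q : ∀ j, M.K.X j ⟶ Y.K.X j
  p_zero : p 0 = M.left.hom
  isProd : ∀ j, j + 1 ≤ n → Nonempty (IsLimit (BinaryFan.mk (p (j + 1)) (q (j + 1))))
  q_last : q (n + 1) ≫ Y.right.hom = M.right.hom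
  d_p : ∀ j, j + 1 ≤ n → M.K.d j (j + 1) ≫ p (j + 1) = -(p j ≫ X.K.d (j + 1) (j + 2))
  d_q_zero : M.K.d 0 1 ≫ q 1 = p 0 ≫ f.f 1
  d_q : ∀ j, j + 1 ≤ n → M.K.d (j + 1) (j + 2) ≫ q (j + 2) =
    p (j + 1) ≫ f.f (j + 2) + q (j + 1) ≫ Y.K.d (j + 1) (j + 2)

/-- `N` is (isomorphic to) the mapping cocone
`X₀ → X₁ ⊕ Y₀ → X₂ ⊕ Y₁ → ⋯ → Xₙ ⊕ Yₙ₋₁ → Yₙ` of `h : X ⟶ Y` (the mapping cone in the opposite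
category), whose differentials have the components `d : Xᵢ → Xᵢ₊₁`, `h : Xᵢ → Yᵢ` and
`-d : Yᵢ₋₁ → Yᵢ`.  Here `p j` and `q j` are the projections of the terms of degree `j` and `j + 1`
to `Xⱼ` and `Yⱼ`, respectively; the terms of degree `1, …, n` are (bi)products. -/
structure MappingCocone {X : NComplex n A B} {Y : NComplex n A' B'}
    (h : X.K ⟶ Y.K) (N : NComplex n A (Y.K.X n)) where
  p : ∀ j, N.K.X j ⟶ X.K.X j
  q : ∀ j, N.K.X (j + 1) ⟶ Y.K.X j
  p_zero : p 0 ≫ X.left.hom = N.left.hom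
  isProd : ∀ j, j + 1 ≤ n → Nonempty (IsLimit (BinaryFan.mk (p (j + 1)) (q j)))
  q_last : q n = N.right.hom
  d_p : ∀ j, j + 1 ≤ n → N.K.d j (j + 1) ≫ p (j + 1) = p j ≫ X.K.d j (j + 1)
  d_q_zero : N.K.d 0 1 ≫ q 0 = p 0 ≫ h.f 0
  d_q : ∀ j, j + 1 ≤ n → N.K.d (j + 1) (j + 2) ≫ q (j + 1) =
    p (j + 1) ≫ h.f (j + 1) - q j ≫ Y.K.d j (j + 1)

end NComplex

/-- The pair `⟨X, δ⟩` is an `n`-exangle: `δ` is annihilated by the first and the last differential,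
and the sequences
`C(-, X₀) → C(-, X₁) → ⋯ → C(-, Xₙ₊₁) → 𝔼(-, X₀)` and
`C(Xₙ₊₁, -) → C(Xₙ, -) → ⋯ → C(X₀, -) → 𝔼(Xₙ₊₁, -)` are exact. -/
structure IsNExangle (𝔼 : ExtBifunctor.{w} k C) {n : ℕ} {A B : C} (X : NComplex n A B)
    (δ : 𝔼.Ext B A) : Prop where
  push_eq_zero : 𝔼.push X.dFirst δ = 0
  pull_eq_zero : 𝔼.pull X.dLast δ = 0
  exact_left : ∀ (T : C) (i : ℕ), i < n →
    Function.Exact (fun y : T ⟶ X.K.X i => y ≫ X.K.d i (i + 1))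
      (fun x : T ⟶ X.K.X (i + 1) => x ≫ X.K.d (i + 1) (i + 2))
  exact_left_last : ∀ T : C,
    Function.Exact (fun y : T ⟶ X.K.X n => y ≫ X.dLast) (fun x : T ⟶ B => 𝔼.pull x δ)
  exact_right : ∀ (T : C) (i : ℕ), i < n →
    Function.Exact (fun y : X.K.X (i + 2) ⟶ T => X.K.d (i + 1) (i + 2) ≫ y)
      (fun x : X.K.X (i + 1) ⟶ T => X.K.d i (i + 1) ≫ x)
  exact_right_last : ∀ T : C,
    Function.Exact (fun y : X.K.X 1 ⟶ T => X.dFirst ≫ y) (fun x : A ⟶ T => 𝔼.push x δ)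

end

/-! ### `n`-exangulated categories -/

/-- A `k`-bilinear bifunctor `𝔼` together with an exact realization `𝔰`: to each extension
`δ ∈ 𝔼(B, A)` the realization associates a homotopy equivalence class `𝔰(δ)` of complexes with end
terms `A` and `B`. -/
structure ExactRealization (k : Type uk) [CommRing k] (C : Type u) [Category.{v} C] [Preadditive C]
    [Linear k C] [HasFiniteBiproducts C] (n : ℕ) where
  𝔼 : ExtBifunctor.{w} k C
  𝔰 : ∀ {A B : C}, 𝔼.Ext B A → Set (NComplex n A B)
  isClass : ∀ {A B : C} (δ : 𝔼.Ext B A),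
    ∃ X : NComplex n A B, 𝔰 δ = {Y | NComplex.HomotopyEquivalent X Y}
  /-- Every morphism of extensions `(a, b) : δ → ρ` lifts to the realizations. -/
  lift : ∀ {A B A' B' : C} (δ : 𝔼.Ext B A) (ρ : 𝔼.Ext B' A') (X : NComplex n A B)
    (Y : NComplex n A' B'), X ∈ 𝔰 δ → Y ∈ 𝔰 ρ → ∀ (a : A ⟶ A') (b : B ⟶ B'),
    𝔼.push a δ = 𝔼.pull b ρ →
    ∃ f : X.K ⟶ Y.K, NComplex.HasEnds (X := X) (Y := Y) f a b
  isNExangle : ∀ {A B : C} (δ : 𝔼.Ext B A) (X : NComplex n A B), X ∈ 𝔰 δ → IsNExangle 𝔼 X δ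
  /-- `0 ∈ 𝔼(0, A)` is realized by `A = A → 0 → ⋯ → 0`. -/
  realize_zero_left : ∀ (A : C) (X : NComplex n A (0 : C)), IsIso (X.K.d 0 1) →
    (∀ i, 2 ≤ i → IsZero (X.K.X i)) → X ∈ 𝔰 (0 : 𝔼.Ext 0 A)
  /-- `0 ∈ 𝔼(A, 0)` is realized by `0 → ⋯ → 0 → A = A`. -/
  realize_zero_right : ∀ (A : C) (X : NComplex n (0 : C) A), IsIso (X.K.d n (n + 1)) →
    (∀ i, i < n → IsZero (X.K.X i)) → X ∈ 𝔰 (0 : 𝔼.Ext A 0)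

section

variable {k : Type uk} [CommRing k] {C : Type u} [Category.{v} C] [Preadditive C]
    [Linear k C] [HasFiniteBiproducts C] {n : ℕ}

namespace ExactRealization

variable (S : ExactRealization.{w} k C n)

/-- `f` is an inflation: it is the first differential of some conflation. -/
def IsInflation {Y Z : C} (f : Y ⟶ Z) : Prop :=
  ∃ (B : C) (δ : S.𝔼.Ext B Y) (X : NComplex n Y B) (e : X.K.X 1 ≅ Z),
    X ∈ S.𝔰 δ ∧ X.dFirst ≫ e.hom = f

/-- `g` is a deflation: it is the last differential of some conflation. -/
def IsDeflation {Y Z : C} (g : Y ⟶ Z) : Prop :=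
  ∃ (A : C) (δ : S.𝔼.Ext Z A) (X : NComplex n A Z) (e : Y ≅ X.K.X n),
    X ∈ S.𝔰 δ ∧ e.hom ≫ X.dLast = g

/-- The condition analogous to (WIC): if `g ∘ f` is a deflation then so is `g`, and if `g ∘ f` is an
inflation then so is `f`. -/
structure WIC : Prop where
  deflation : ∀ {X Y Z : C} (f : X ⟶ Y) (g : Y ⟶ Z), S.IsDeflation (f ≫ g) → S.IsDeflation g
  inflation : ∀ {X Y Z : C} (f : X ⟶ Y) (g : Y ⟶ Z), S.IsInflation (f ≫ g) → S.IsInflation f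

/-- All extension modules are finitely generated. -/
def ExtFinite : Prop := ∀ B A : C, Module.Finite k (S.𝔼.Ext B A)

/-- The membership `X ∈ C_r`: the functor `D𝔼(X, -)` on the costable category is representable,
where `D = Hom_k(-, I)`. -/
def MemCr (I : Type uk) [AddCommGroup I] [Module k I] (X : C) : Prop :=
  IsLinearRepresentable (k := k) (S.𝔼.dualExt I X)

end ExactRealization

end

/-- A `k`-linear `n`-exangulated category structure `(C, 𝔼, 𝔰)` on `C`. -/
structure NExangulated (k : Type uk) [CommRing k] (C : Type u) [Category.{v} C] [Preadditive C]
    [Linear k C] [HasFiniteBiproducts C] (n : ℕ) extends ExactRealization.{w} k C n where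
  comp_inflation : ∀ {X Y Z : C} (f : X ⟶ Y) (g : Y ⟶ Z),
    toExactRealization.IsInflation f → toExactRealization.IsInflation g →
    toExactRealization.IsInflation (f ≫ g)
  comp_deflation : ∀ {X Y Z : C} (f : X ⟶ Y) (g : Y ⟶ Z),
    toExactRealization.IsDeflation f → toExactRealization.IsDeflation g →
    toExactRealization.IsDeflation (f ≫ g)
  /-- For `ρ ∈ 𝔼(D, A)` and `c : B ⟶ D`, the morphism `(id_A, c) : c^*ρ → ρ` has a good lift. -/
  good_lift : ∀ {A B D : C} (ρ : 𝔼.Ext D A) (c : B ⟶ D) (X : NComplex n A B)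
    (Y : NComplex n A D), X ∈ 𝔰 (𝔼.pull c ρ) → Y ∈ 𝔰 ρ →
    ∃ f : X.K ⟶ Y.K, NComplex.HasEnds (X := X) (Y := Y) f (𝟙 A) c ∧
      ∃ M : NComplex n (X.K.X 1) D, Nonempty (NComplex.MappingCone (X := X) (Y := Y) f M) ∧
        M ∈ 𝔰 (𝔼.push X.dFirst ρ)
  /-- For `ρ ∈ 𝔼(D, A)` and `a : A ⟶ B`, the morphism `(a, id_D) : ρ → a_*ρ` has a good lift. -/
  good_lift_op : ∀ {A B D : C} (ρ : 𝔼.Ext D A) (a : A ⟶ B) (X : NComplex n A D)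
    (Y : NComplex n B D), X ∈ 𝔰 ρ → Y ∈ 𝔰 (𝔼.push a ρ) →
    ∃ h : X.K ⟶ Y.K, NComplex.HasEnds (X := X) (Y := Y) h a (𝟙 D) ∧
      ∃ N : NComplex n A (Y.K.X n), Nonempty (NComplex.MappingCocone (X := X) (Y := Y) h N) ∧
        N ∈ 𝔰 (𝔼.pull Y.dLast ρ)

/-! ### Krull-Schmidt categories and determined morphisms -/

/-- Every object is a finite direct sum of objects with local endomorphism rings. -/
def IsKrullSchmidt (C : Type u) [Category.{v} C] [Preadditive C] [HasFiniteBiproducts C] : Prop :=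
  ∀ X : C, ∃ (m : ℕ) (Y : Fin m → C),
    (∀ i, IsLocalRing (End (Y i))) ∧ Nonempty (X ≅ ⨁ Y)

/-- `f : X ⟶ Y` is right `D`-determined: a morphism `g : L ⟶ Y` factors through `f` as soon as
`g ∘ h` factors through `f` for every `h : D ⟶ L`. -/
def IsRightDetermined {C : Type u} [Category.{v} C] (D : C) {X Y : C} (f : X ⟶ Y) : Prop :=
  ∀ (L : C) (g : L ⟶ Y), (∀ h : D ⟶ L, ∃ s : D ⟶ X, s ≫ f = h ≫ g) → ∃ t : L ⟶ X, t ≫ f = g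

end HigherExact

end

/-! By Krull–Schmidt, `X` is a finite direct sum of objects `Y` with local endomorphism rings, and
universal elements for the functors `D𝔼(Y, -)` assemble to one for `X`; so it suffices to treat one
`Y` with `𝔼(Y, -) ≠ 0`. The maps `X ⟶ Y` that are not split epimorphisms form a submodule containing
the projectively trivial ones. The determined deflation with this image comes from an almost split
extension `ρ` (`exists_isAlmostSplit`), and a component of `ρ` has a left term `Z` with local
endomorphism ring.

Exactness of the sequences of a conflation then shows that every nonzero extension of `Y` pushes to
`ρ` and every nonzero extension by `Z` pulls back to `ρ`. Take `φ : 𝔼(Y, Z) → I` with `φ ρ ≠ 0`. The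
pairing `(g, δ) ↦ φ (g_* δ)` on `C(T, Z) × 𝔼(Y, T)` is nondegenerate in `δ`, and its kernel in `g`
consists of the injectively trivial maps. As `D` does not increase length, nondegeneracy in `δ`
makes `C(T, Z) → D𝔼(Y, T)` surjective, whence `C̄(T, Z) ≅ D𝔼(Y, T)`. -/

namespace HigherExact

/-! ### Duality with respect to the minimal injective cogenerator. -/

section Duality

variable {k : Type uk} [CommRing k]

lemma isSimpleModule_span_singleton {M : Type*} [AddCommGroup M] [Module k M] (m : Ideal k)
    [hm : m.IsMaximal] {y : M} (hy : y ≠ 0) (h : ∀ a ∈ m, a • y = 0) :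
    IsSimpleModule k (Submodule.span k {y}) := by
  have htor : m = Ideal.torsionOf k M y :=
    hm.eq_of_le (by rwa [ne_eq, Ideal.torsionOf_eq_top_iff])
      (fun a ha => (Ideal.mem_torsionOf_iff y a).2 (h a ha))
  have : IsSimpleModule k (k ⧸ Ideal.torsionOf k M y) :=
    isSimpleModule_iff_isCoatom.2 (htor ▸ hm.out)
  exact IsSimpleModule.congr (Ideal.quotTorsionOfEquivSpanSingleton k M y).symm

/-- A finitely generated injective object of `k`-mod containing a copy of every simple module is an
injective cogenerator. -/
lemma IsInjectiveCogenerator.of_simples {Q : Type uk} [AddCommGroup Q] [Module k Q]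
    (hfin : Module.Finite k Q)
    (hinj : ∀ (M N : Type uk) [AddCommGroup M] [Module k M] [AddCommGroup N] [Module k N]
      [Module.Finite k M] [Module.Finite k N] (i : M →ₗ[k] N) (f : M →ₗ[k] Q),
      Function.Injective i → ∃ g : N →ₗ[k] Q, g ∘ₗ i = f)
    (hsimple : ∀ m : Ideal k, m.IsMaximal → ∃ q : Q, q ≠ 0 ∧ ∀ a ∈ m, a • q = 0) :
    IsInjectiveCogenerator k Q where
  finite := hfin
  injective := hinj
  cogenerates M _ _ _ x hx := by
    have hne : Ideal.torsionOf k M x ≠ ⊤ := by rwa [ne_eq, Ideal.torsionOf_eq_top_iff]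
    obtain ⟨m, hm, hle⟩ := Ideal.exists_le_maximal _ hne
    obtain ⟨q, hq, hqm⟩ := hsimple m hm
    -- The annihilator of `x` lies in `m`, so `x ↦ q` is well defined on the span of `x`;
    -- injectivity extends it to `M`.
    let φ : (k ⧸ Ideal.torsionOf k M x) →ₗ[k] Q :=
      Submodule.liftQ _ (LinearMap.toSpanSingleton k Q q) (fun a ha => by
        simpa using hqm a (hle ha))
    let e := Ideal.quotTorsionOfEquivSpanSingleton k M x
    obtain ⟨g, hg⟩ := hinj _ M (Submodule.span k {x}).subtype (φ ∘ₗ e.symm.toLinearMap)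
      Subtype.val_injective
    refine ⟨g, ?_⟩
    have h1 := LinearMap.congr_fun hg (e (Submodule.Quotient.mk 1))
    have h2 : ((e (Submodule.Quotient.mk 1) : Submodule.span k {x}) : M) = x := by
      rw [Ideal.quotTorsionOfEquivSpanSingleton_apply_mk, one_smul]
    rw [LinearMap.comp_apply, Submodule.subtype_apply, h2] at h1
    rw [h1, LinearMap.comp_apply, LinearEquiv.coe_coe, e.symm_apply_apply, Submodule.liftQ_apply,
      LinearMap.toSpanSingleton_apply, one_smul]
    exact hq

variable {I : Type uk} [AddCommGroup I] [Module k I]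

lemma IsInjectiveCogenerator.exists_simple (hI : IsInjectiveCogenerator k I) (m : Ideal k)
    (hm : m.IsMaximal) : ∃ q : I, q ≠ 0 ∧ ∀ a ∈ m, a • q = 0 := by
  have : Nontrivial (k ⧸ m) := Ideal.Quotient.nontrivial_iff.2 hm.ne_top
  obtain ⟨f, hf⟩ := hI.cogenerates (k ⧸ m) 1 one_ne_zero
  refine ⟨f 1, hf, fun a ha => ?_⟩
  rw [← map_smul]
  have : a • (1 : k ⧸ m) = 0 := by
    rw [Algebra.smul_def, mul_one]
    exact Ideal.Quotient.eq_zero_iff_mem.2 ha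
  rw [this, map_zero]

/-- A direct summand inherits finiteness and injectivity through the projection, so only the simple
submodules have to be checked. -/
lemma IsInjectiveCogenerator.of_isCompl (hI : IsInjectiveCogenerator k I) {Q Q' : Submodule k I}
    (hQ : IsCompl Q Q')
    (hsimple : ∀ m : Ideal k, m.IsMaximal → ∃ q ∈ Q, q ≠ 0 ∧ ∀ a ∈ m, a • q = 0) :
    IsInjectiveCogenerator k Q := by
  have := hI.finite
  refine .of_simples (.of_surjective (Q.projectionOnto Q' hQ)
    (Submodule.projectionOnto_surjective hQ)) ?_ ?_
  · intro M N _ _ _ _ _ _ i f hi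
    obtain ⟨g, hg⟩ := hI.injective M N i (Q.subtype ∘ₗ f) hi
    refine ⟨Q.projectionOnto Q' hQ ∘ₗ g, ?_⟩
    rw [LinearMap.comp_assoc, hg, ← LinearMap.comp_assoc, Submodule.projectionOnto_comp_subtype,
      LinearMap.id_comp]
  · intro m hm
    obtain ⟨q, hqQ, hq, h⟩ := hsimple m hm
    exact ⟨⟨q, hqQ⟩, by simpa using hq, fun a ha => Subtype.ext (h a ha)⟩

/-- An endomorphism of the minimal injective cogenerator which fixes a copy of every simple module
is injective: its Fitting component is again an injective cogenerator. -/
lemma IsMinimalInjectiveCogenerator.injective_of_fixes_simples [IsArtinianRing k]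
    (hI : IsMinimalInjectiveCogenerator k I) (e : Module.End k I)
    (he : ∀ m : Ideal k, m.IsMaximal → ∃ q : I, e q = q ∧ q ≠ 0 ∧ ∀ a ∈ m, a • q = 0) :
    Function.Injective e := by
  have := hI.finite
  have : IsNoetherian k I := inferInstance
  obtain ⟨N, hN⟩ := Filter.eventually_atTop.1 e.eventually_isCompl_ker_pow_range_pow
  -- A positive exponent ensures `ker e ≤ ker (e ^ (N + 1))`.
  have hc := hN (N + 1) (Nat.le_succ N)
  have htop := hI.minimal (LinearMap.range (e ^ (N + 1))) (hI.of_isCompl hc.symm (by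
    intro m hm
    obtain ⟨q, h1, h2, h3⟩ := he m hm
    have hq : ∀ j : ℕ, (e ^ j) q = q := by
      intro j
      induction j with
      | zero => simp
      | succ j ih => rw [pow_succ, Module.End.mul_apply, h1, ih]
    exact ⟨q, ⟨q, hq _⟩, h2, h3⟩))
  rw [htop] at hc
  have hker : LinearMap.ker (e ^ (N + 1)) = ⊥ := by simpa using hc.disjoint.eq_bot
  rw [← LinearMap.ker_eq_bot, eq_bot_iff, ← hker]
  intro x hx
  rw [LinearMap.mem_ker] at hx ⊢
  rw [pow_succ, Module.End.mul_apply, hx, map_zero]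

/-- The socle of the minimal injective cogenerator is multiplicity free. -/
lemma IsMinimalInjectiveCogenerator.mem_span_of_simple [IsArtinianRing k]
    (hI : IsMinimalInjectiveCogenerator k I) (m : Ideal k) (hm : m.IsMaximal) {x y : I}
    (hx : x ≠ 0) (hxm : ∀ a ∈ m, a • x = 0) (hym : ∀ a ∈ m, a • y = 0) :
    y ∈ Submodule.span k {x} := by
  by_contra hyx
  have := hI.finite
  -- `A` is the socle. If `y` were outside the span of `x`, the projection of `A` killing `x` would
  -- extend to an endomorphism `e` of `I` that still fixes a copy of every simple module, hence is
  -- injective, although `e x = 0`.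
  let A : Submodule k I := ⨆ S ∈ {S : Submodule k I | IsSimpleModule k S}, S
  have hss : IsSemisimpleModule k A :=
    isSemisimpleModule_biSup_of_isSemisimpleModule_submodule fun S hS => by
      have : IsSimpleModule k S := hS
      infer_instance
  have hA : ∀ (m : Ideal k), m.IsMaximal → ∀ z : I, (∀ a ∈ m, a • z = 0) → z ∈ A := by
    intro m hm z hz
    by_cases h0 : z = 0
    · rw [h0]; exact A.zero_mem
    · have : IsSimpleModule k (Submodule.span k {z}) := isSimpleModule_span_singleton m h0 hz
      exact le_iSup₂_of_le (f := fun (S : Submodule k I)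
        (_ : S ∈ {S : Submodule k I | IsSimpleModule k S}) => S) _ this le_rfl
        (Submodule.mem_span_singleton_self z)
  let x' : A := ⟨x, hA m hm x hxm⟩
  obtain ⟨W, hW⟩ := exists_isCompl (Submodule.span k {x'})
  let p : A →ₗ[k] A := W.subtype ∘ₗ W.projectionOnto _ hW.symm
  obtain ⟨e, he⟩ := hI.injective A I A.subtype (A.subtype ∘ₗ p) Subtype.val_injective
  have he' : ∀ z : A, e z = p z := fun z => LinearMap.congr_fun he z
  have hpx : p x' = 0 := by
    simp [p, Submodule.mem_span_singleton_self]
  refine hx ((hI.injective_of_fixes_simples e ?_) ?_)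
  · intro m' hm'
    -- A vector outside the span of `x` has nonzero projection. For `m' = m` take `y`; for `m' ≠ m`
    -- a nonzero vector killed by `m'` cannot be a multiple of `x`, because `m ⊔ m' = ⊤`.
    have hex : ∃ y' : I, (∀ a ∈ m', a • y' = 0) ∧ y' ∉ Submodule.span k {x} := by
      by_cases hmm : m' = m
      · exact ⟨y, hmm ▸ hym, hyx⟩
      · obtain ⟨q, hq, hqm⟩ := hI.exists_simple m' hm'
        refine ⟨q, hqm, fun hqx => hq ?_⟩
        obtain ⟨c, rfl⟩ := Submodule.mem_span_singleton.1 hqx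
        have hcop : m ⊔ m' = ⊤ := Ideal.IsMaximal.coprime_of_ne hm hm' (Ne.symm hmm)
        obtain ⟨a, ha, b, hb, hab⟩ := Submodule.mem_sup.1 (hcop ▸ Submodule.mem_top (x := (1 : k)))
        rw [← one_smul k (c • x), ← hab, add_smul, hqm b hb, smul_comm, hxm a ha, smul_zero,
          add_zero]
    obtain ⟨y', hy'm, hy'⟩ := hex
    let z : A := ⟨y', hA m' hm' y' hy'm⟩
    refine ⟨p z, ?_, ?_, ?_⟩
    · rw [he']
      congr 1
      simp [p]
    · intro h0
      have h0' : W.projectionOnto _ hW.symm z = 0 := by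
        apply Subtype.ext; apply Subtype.ext; exact h0
      rw [Submodule.projectionOnto_apply_eq_zero_iff, Submodule.mem_span_singleton] at h0'
      obtain ⟨c, hc⟩ := h0'
      exact hy' (Submodule.mem_span_singleton.2 ⟨c, congrArg Subtype.val hc⟩)
    · intro a ha
      have : a • z = 0 := Subtype.ext (hy'm a ha)
      rw [← Submodule.coe_smul, ← map_smul, this, map_zero, Submodule.coe_zero]
  · rw [map_zero]
    exact (he' x').trans (by rw [hpx, Submodule.coe_zero])

/-- A functional is determined by its value at a generator, and this value lies in a part of the
socle of `I` that is spanned by any of its nonzero elements. -/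
lemma IsMinimalInjectiveCogenerator.length_dual_simple_le [IsArtinianRing k]
    (hI : IsMinimalInjectiveCogenerator k I) (M : Type w) [AddCommGroup M] [Module k M]
    [IsSimpleModule k M] : Module.length k (M →ₗ[k] I) ≤ 1 := by
  by_cases hsub : Subsingleton (M →ₗ[k] I)
  · rw [Module.length_eq_zero]; exact zero_le_one
  have hnt : Nontrivial (M →ₗ[k] I) := not_subsingleton_iff_nontrivial.1 hsub
  have hM := isSimpleModule_iff_toSpanSingleton_surjective.1 (inferInstance : IsSimpleModule k M)
  have := hM.1
  obtain ⟨s, hs⟩ := exists_ne (0 : M)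
  have hgen := hM.2 s hs
  have hm : (Module.annihilator k M).IsMaximal := IsSimpleModule.annihilator_isMaximal
  have key : ∀ f : M →ₗ[k] I, ∀ a ∈ Module.annihilator k M, a • f s = 0 := by
    intro f a ha
    rw [← map_smul, Module.mem_annihilator.1 ha, map_zero]
  have hext : ∀ f g : M →ₗ[k] I, f s = g s → f = g := by
    intro f g h
    ext t
    obtain ⟨a, rfl⟩ := hgen t
    simp [h]
  have : IsSimpleModule k (M →ₗ[k] I) := by
    rw [isSimpleModule_iff_toSpanSingleton_surjective]
    refine ⟨hnt, fun f hf g => ?_⟩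
    have hfs : f s ≠ 0 := fun h => hf (hext f 0 (by simpa using h))
    obtain ⟨a, ha⟩ := Submodule.mem_span_singleton.1
      (hI.mem_span_of_simple _ hm hfs (key f) (key g))
    exact ⟨a, hext _ _ (by simpa using ha)⟩
  rw [Module.length_eq_one]

/-- Induction along a composition series: the functionals vanishing on `N` come from `M ⧸ N`, so
each simple factor contributes at most one. -/
lemma IsMinimalInjectiveCogenerator.length_dual_le [IsArtinianRing k]
    (hI : IsMinimalInjectiveCogenerator k I) (M : Type w) [AddCommGroup M] [Module k M]
    (hM : IsFiniteLength k M) : Module.length k (M →ₗ[k] I) ≤ Module.length k M := by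
  induction hM with
  | of_subsingleton => rw [Module.length_eq_zero]; exact zero_le
  | @of_simple_quotient M _ _ N _ _ ih =>
    let r : (M →ₗ[k] I) →ₗ[k] (N →ₗ[k] I) := LinearMap.lcomp k I N.subtype
    let i : ((M ⧸ N) →ₗ[k] I) →ₗ[k] LinearMap.ker r :=
      LinearMap.codRestrict _ (LinearMap.lcomp k I N.mkQ) (fun f => by
        ext x
        exact (congrArg f ((Submodule.Quotient.mk_eq_zero N).2 x.2)).trans (map_zero f))
    have hi : Function.Surjective i := by
      rintro ⟨f, hf⟩
      refine ⟨N.liftQ f (fun x hx => ?_), ?_⟩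
      · exact LinearMap.congr_fun (LinearMap.mem_ker.1 hf) ⟨x, hx⟩
      · apply Subtype.ext
        ext; rfl
    have hker : Module.length k (LinearMap.ker r) ≤ 1 :=
      (Module.length_le_of_surjective i hi).trans (hI.length_dual_simple_le _)
    rw [Module.length_eq_add_of_exact N.subtype N.mkQ N.subtype_injective N.mkQ_surjective
        (LinearMap.exact_subtype_mkQ N),
      Module.length_eq_add_of_exact (LinearMap.ker r).subtype r.rangeRestrict
        (LinearMap.ker r).subtype_injective r.surjective_rangeRestrict
        (by rw [LinearMap.exact_iff]; simp), Module.length_eq_one k (M ⧸ N), add_comm]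
    exact add_le_add ((Module.length_le_of_injective _ (LinearMap.range r).subtype_injective).trans
      ih) hker

/-- Transfers the cogenerator property to another universe, by replacing `M` with an isomorphic
quotient of a finite free module. -/
lemma IsInjectiveCogenerator.exists_ne_zero (hI : IsInjectiveCogenerator k I) {M : Type w}
    [AddCommGroup M] [Module k M] [Module.Finite k M] {x : M} (hx : x ≠ 0) :
    ∃ f : M →ₗ[k] I, f x ≠ 0 := by
  obtain ⟨n, g, hg⟩ := Module.Finite.exists_fin' k M
  let e := g.quotKerEquivOfSurjective hg
  obtain ⟨f, hf⟩ := hI.cogenerates _ (e.symm x) (by simpa using hx)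
  exact ⟨f ∘ₗ e.symm.toLinearMap, hf⟩

/-- A pairing which is nondegenerate in its finitely generated second variable represents every
functional on that variable. -/
lemma IsMinimalInjectiveCogenerator.surjective_of_nondegenerate [IsArtinianRing k]
    (hI : IsMinimalInjectiveCogenerator k I) {H : Type v} {E : Type w} [AddCommGroup H]
    [Module k H] [AddCommGroup E] [Module k E] [Module.Finite k E] (β : H →ₗ[k] E →ₗ[k] I)
    (hβ : ∀ x : E, (∀ g, β g x = 0) → x = 0) : Function.Surjective β := by
  have hlen : ∀ (M : Type w) [AddCommGroup M] [Module k M] [Module.Finite k M],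
      IsFiniteLength k M := fun M _ _ _ =>
    isFiniteLength_iff_isNoetherian_isArtinian.2 ⟨inferInstance, inferInstance⟩
  have hDE := hI.length_dual_le E (hlen E)
  have hEt : Module.length k E ≠ ⊤ := Module.length_ne_top_iff.2 (hlen E)
  have hDfl : IsFiniteLength k (E →ₗ[k] I) :=
    Module.length_ne_top_iff.1 (ne_top_of_le_ne_top hEt hDE)
  obtain ⟨_, _⟩ := isFiniteLength_iff_isNoetherian_isArtinian.1 hDfl
  let R := LinearMap.range β
  have hR : IsFiniteLength k R :=
    isFiniteLength_iff_isNoetherian_isArtinian.2 ⟨inferInstance, inferInstance⟩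
  let ev : E →ₗ[k] R →ₗ[k] I := R.subtype.flip
  have hev : Function.Injective ev := by
    rw [← LinearMap.ker_eq_bot, eq_bot_iff]
    intro x hx
    exact hβ x fun g => LinearMap.congr_fun (LinearMap.mem_ker.1 hx) ⟨β g, g, rfl⟩
  -- If the range `R` were proper, then `length E ≤ length (D R) ≤ length R < length (D E) ≤ length
  -- E`.
  rw [← LinearMap.range_eq_top]
  by_contra hne
  exact absurd ((Module.length_le_of_injective ev hev).trans (hI.length_dual_le R hR))
    (not_le.2 ((Submodule.length_lt hne).trans_le hDE))

end Duality

end HigherExact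

noncomputable section
namespace HigherExact

/-! ### Split epimorphisms and the bifunctor of extensions. -/

section

variable {k : Type uk} [CommRing k] {C : Type u} [Category.{v} C] [Preadditive C] [Linear k C]

lemma sum_comp_eq_id_of_iso [HasFiniteBiproducts C] {m : ℕ} {X : C}
    {Y : Fin m → C} (e : X ≅ ⨁ Y) :
    ∑ i, (e.hom ≫ biproduct.π Y i) ≫ biproduct.ι Y i ≫ e.inv = 𝟙 X := by
  have : ∑ i, (e.hom ≫ biproduct.π Y i) ≫ biproduct.ι Y i ≫ e.inv =
      e.hom ≫ (∑ i, biproduct.π Y i ≫ biproduct.ι Y i) ≫ e.inv := by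
    rw [Preadditive.sum_comp, Preadditive.comp_sum]
    simp only [Category.assoc]
  rw [this, biproduct.total, Category.id_comp, e.hom_inv_id]

/-- In a local ring one of two summands of `1` is a unit. This makes the maps that are not split
epimorphisms closed under addition. -/
lemma isSplitEpi_of_add {Y L M : C} [IsLocalRing (End Y)] {f : L ⟶ Y} {g : M ⟶ Y} {s : Y ⟶ L}
    {t : Y ⟶ M} (h : s ≫ f + t ≫ g = 𝟙 Y) : IsSplitEpi f ∨ IsSplitEpi g := by
  have key : ∀ {K : C} (p : Y ⟶ K) (q : K ⟶ Y), IsUnit (M := End Y) (p ≫ q) → IsSplitEpi q := by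
    intro K p q hu
    have : IsIso (p ≫ q) := (isUnit_iff_isIso _).1 hu
    exact ⟨⟨inv (p ≫ q) ≫ p, by rw [Category.assoc, IsIso.inv_hom_id]⟩⟩
  exact (IsLocalRing.isUnit_or_isUnit_of_add_one (R := End Y) h).imp (key s f) (key t g)

/-- The morphisms from `X` to an object `Y` with local endomorphism ring which are not split
epimorphisms. -/
def nonSplitEpi (X Y : C) [IsLocalRing (End Y)] : Submodule (End X)ᵐᵒᵖ (X ⟶ Y) where
  carrier := {f | ¬ IsSplitEpi f}
  add_mem' {f g} hf hg := by
    rintro ⟨⟨s, hs⟩⟩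
    rw [Preadditive.comp_add] at hs
    exact (isSplitEpi_of_add hs).elim hf hg
  zero_mem' := by
    rintro ⟨⟨s, hs⟩⟩
    rw [comp_zero] at hs
    exact zero_ne_one (α := End Y) hs
  smul_mem' a f hf := by
    rintro ⟨⟨s, hs⟩⟩
    exact hf ⟨⟨s ≫ a.unop, (Category.assoc _ _ _).trans hs⟩⟩

/-- An almost split extension of `Y`. -/
structure IsAlmostSplit (𝔼 : ExtBifunctor.{w} k C) {Y Z : C} (ρ : 𝔼.Ext Y Z) : Prop where
  ne_zero : ρ ≠ 0
  pull_eq_zero : ∀ {L : C} (g : L ⟶ Y), ¬ IsSplitEpi g → 𝔼.pull g ρ = 0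

namespace ExtBifunctor

variable (𝔼 : ExtBifunctor.{w} k C)

lemma push_add {B A A' : C} (a a' : A ⟶ A') (δ : 𝔼.Ext B A) :
    𝔼.push (a + a') δ = 𝔼.push a δ + 𝔼.push a' δ := by
  simp [push, 𝔼.map_add_right]

lemma push_zero {B A A' : C} (δ : 𝔼.Ext B A) : 𝔼.push (0 : A ⟶ A') δ = 0 := by
  simpa using 𝔼.push_sub (0 : A ⟶ A') 0 δ

lemma pull_comp {B B' B'' A : C} (b : B' ⟶ B) (b' : B'' ⟶ B') (δ : 𝔼.Ext B A) :
    𝔼.pull (b' ≫ b) δ = 𝔼.pull b' (𝔼.pull b δ) := by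
  simp [pull]

lemma pull_id {B A : C} (δ : 𝔼.Ext B A) : 𝔼.pull (𝟙 B) δ = δ := by
  simp [pull]

lemma pull_add {B B' A : C} (b b' : B' ⟶ B) (δ : 𝔼.Ext B A) :
    𝔼.pull (b + b') δ = 𝔼.pull b δ + 𝔼.pull b' δ := by
  simp only [pull, 𝔼.map_add_left]
  simp

lemma pull_zero {B B' A : C} (δ : 𝔼.Ext B A) : 𝔼.pull (0 : B' ⟶ B) δ = 0 := by
  have h := 𝔼.pull_add (0 : B' ⟶ B) 0 δ
  rwa [add_zero, left_eq_add] at h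

lemma push_sum {B A A' : C} {ι : Type*} (s : Finset ι) (a : ι → (A ⟶ A')) (δ : 𝔼.Ext B A) :
    𝔼.push (∑ i ∈ s, a i) δ = ∑ i ∈ s, 𝔼.push (a i) δ :=
  map_sum (AddMonoidHom.mk' (fun a : A ⟶ A' => 𝔼.push a δ) fun a a' => 𝔼.push_add a a' δ) a s

lemma pull_sum {B B' A : C} {ι : Type*} (s : Finset ι) (b : ι → (B' ⟶ B)) (δ : 𝔼.Ext B A) :
    𝔼.pull (∑ i ∈ s, b i) δ = ∑ i ∈ s, 𝔼.pull (b i) δ :=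
  map_sum (AddMonoidHom.mk' (fun b : B' ⟶ B => 𝔼.pull b δ) fun b b' => 𝔼.pull_add b b' δ) b s

/-! ### Universal elements and representability. -/

variable {I : Type uk} [AddCommGroup I] [Module k I]

/-- The map `C(T, Z) → D𝔼(X, T)` which corresponds to `φ ∈ D𝔼(X, Z)` under the Yoneda lemma. -/
def toDualExt {X Z : C} (φ : 𝔼.Ext X Z →ₗ[k] I) (T : C) :
    (T ⟶ Z) →ₗ[k] (𝔼.Ext X T →ₗ[k] I) where
  toFun g := φ ∘ₗ 𝔼.push g
  map_add' g g' := by ext δ; simp [push_add]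
  map_smul' r g := by ext δ; simp [push_smul]

lemma toDualExt_apply {X Z : C} (φ : 𝔼.Ext X Z →ₗ[k] I) {T : C} (g : T ⟶ Z) (δ : 𝔼.Ext X T) :
    𝔼.toDualExt φ T g δ = φ (𝔼.push g δ) := rfl

/-- The functional `φ ∈ D𝔼(X, Z)` is a universal element of `D𝔼(X, -)` on the costable category. -/
structure IsUniversal {X Z : C} (φ : 𝔼.Ext X Z →ₗ[k] I) : Prop where
  surjective : ∀ T, Function.Surjective (𝔼.toDualExt φ T)
  injTrivial : ∀ {T : C} (g : T ⟶ Z), 𝔼.toDualExt φ T g = 0 → 𝔼.InjTrivial g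

variable {𝔼}

/-- The isomorphism `C̄(T, Z) ≅ D𝔼(X, T)` defined by a universal element. -/
def IsUniversal.equiv {X Z : C} {φ : 𝔼.Ext X Z →ₗ[k] I} (hφ : 𝔼.IsUniversal φ) (T : 𝔼.Costable) :
    (T ⟶ (CategoryTheory.Quotient.functor 𝔼.costableRel).obj Z) ≃ₗ[k] (𝔼.Ext X T.as →ₗ[k] I) :=
  LinearEquiv.ofBijective
    (M := T ⟶ (CategoryTheory.Quotient.functor 𝔼.costableRel).obj Z)
    { toFun := Quot.lift (fun g : T.as ⟶ Z => 𝔼.toDualExt φ T.as g) (fun g g' h => by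
        rw [HomRel.compClosure_iff_self, costableRel_iff] at h
        ext δ
        exact congrArg φ (h X δ))
      map_add' := by
        rintro ⟨g⟩ ⟨g'⟩
        exact map_add (𝔼.toDualExt φ T.as) g g'
      map_smul' := by
        rintro r ⟨g⟩
        exact map_smul (𝔼.toDualExt φ T.as) r g } <| by
    refine ⟨?_, fun ψ => ?_⟩
    · rw [injective_iff_map_eq_zero]
      rintro ⟨g⟩ hg
      have h := hφ.injTrivial g hg
      refine (CategoryTheory.Quotient.sound 𝔼.costableRel (f₁ := g) (f₂ := 0) ?_).trans
        ((CategoryTheory.Quotient.functor 𝔼.costableRel).map_zero _ _)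
      rwa [costableRel, sub_zero]
    · obtain ⟨g, hg⟩ := hφ.surjective T.as ψ
      exact ⟨(CategoryTheory.Quotient.functor 𝔼.costableRel).map g, hg⟩

lemma IsUniversal.isLinearRepresentable {X Z : C} {φ : 𝔼.Ext X Z →ₗ[k] I}
    (hφ : 𝔼.IsUniversal φ) : IsLinearRepresentable (k := k) (𝔼.dualExt I X) := by
  refine ⟨(CategoryTheory.Quotient.functor 𝔼.costableRel).obj Z, fun T => hφ.equiv T, ?_⟩
  rintro T T' ⟨f⟩ ⟨g⟩
  apply LinearMap.ext
  intro δ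
  exact congrArg φ (𝔼.push_comp f g δ)

lemma isUniversal_zero [HasZeroObject C] {X : C} (hX : ∀ (Z : C) (δ : 𝔼.Ext X Z), δ = 0) :
    𝔼.IsUniversal (0 : 𝔼.Ext X 0 →ₗ[k] I) where
  surjective T ψ := ⟨0, by ext δ; rw [hX T δ, map_zero, map_zero]⟩
  injTrivial g _ := fun Z δ => by
    rw [(isZero_zero C).eq_zero_of_tgt g, push_zero]

/-- A universal element for a direct sum. -/
lemma exists_isUniversal_biproduct [HasFiniteBiproducts C] {m : ℕ} {X : C} {Y : Fin m → C}
    (e : X ≅ ⨁ Y) (h : ∀ i, ∃ (Z : C) (φ : 𝔼.Ext (Y i) Z →ₗ[k] I), 𝔼.IsUniversal φ) :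
    ∃ (Z : C) (φ : 𝔼.Ext X Z →ₗ[k] I), 𝔼.IsUniversal φ := by
  choose Z φ hφ using h
  let s : ∀ i, Y i ⟶ X := fun i => biproduct.ι Y i ≫ e.inv
  let r : ∀ i, X ⟶ Y i := fun i => e.hom ≫ biproduct.π Y i
  have hsr : ∀ i, s i ≫ r i = 𝟙 (Y i) := fun i => by simp [s, r]
  have hsr' : ∀ i j, i ≠ j → s i ≫ r j = 0 := fun i j hij => by
    simp [s, r, biproduct.ι_π_ne Y hij]
  have hrs : ∑ i, r i ≫ s i = 𝟙 X := sum_comp_eq_id_of_iso e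
  -- `Φ` applies `φ i` to the diagonal component in `𝔼(Y i, Z i)` and ignores the off-diagonal ones.
  let Φ : 𝔼.Ext X (⨁ Z) →ₗ[k] I := ∑ i, φ i ∘ₗ 𝔼.pull (s i) ∘ₗ 𝔼.push (biproduct.π Z i)
  have hΦ : ∀ {T : C} (g : T ⟶ ⨁ Z) (δ : 𝔼.Ext X T),
      Φ (𝔼.push g δ) = ∑ i, φ i (𝔼.push (g ≫ biproduct.π Z i) (𝔼.pull (s i) δ)) := by
    intro T g δ
    simp [Φ, push_pull, push_comp]
  refine ⟨⨁ Z, Φ, fun T ψ => ?_, fun {T} g hg => ?_⟩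
  · choose g hg using fun i => (hφ i).surjective T (ψ ∘ₗ 𝔼.pull (r i))
    refine ⟨biproduct.lift g, ?_⟩
    ext δ
    rw [toDualExt_apply, hΦ]
    have : ∀ i, φ i (𝔼.push (biproduct.lift g ≫ biproduct.π Z i) (𝔼.pull (s i) δ)) =
        ψ (𝔼.pull (r i ≫ s i) δ) := fun i => by
      rw [biproduct.lift_π, ← toDualExt_apply, hg, 𝔼.pull_comp (s i) (r i)]
      rfl
    rw [Finset.sum_congr rfl fun i _ => this i, ← map_sum, ← pull_sum, hrs, pull_id]
  · have hi : ∀ i, 𝔼.InjTrivial (g ≫ biproduct.π Z i) := fun i => by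
      refine (hφ i).injTrivial _ ?_
      ext δ
      -- Testing on extensions pulled back along `r i` isolates the `i`-th summand, since `s j ≫ r i
      -- = 0` for `j ≠ i`.
      have h := LinearMap.congr_fun hg (𝔼.pull (r i) δ)
      rw [toDualExt_apply, hΦ, Finset.sum_eq_single i, ← pull_comp, hsr, pull_id] at h
      · exact h
      · intro j _ hji
        rw [← pull_comp, hsr' j i hji, pull_zero, map_zero, map_zero]
      · simp
    intro W δ
    have : g = ∑ i, (g ≫ biproduct.π Z i) ≫ biproduct.ι Z i := by
      simp only [Category.assoc]
      rw [← Preadditive.comp_sum, biproduct.total, Category.comp_id]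
    rw [this, push_sum]
    exact Finset.sum_eq_zero fun i _ => by rw [push_comp, hi i, map_zero]

end ExtBifunctor

end

/-! ### Exact sequences of conflations. -/

section

variable {k : Type uk} [CommRing k] {C : Type u} [Category.{v} C] [Preadditive C]
    [Linear k C] [HasFiniteBiproducts C] {n : ℕ}

lemma ExactRealization.exists_realization (S : ExactRealization.{w} k C n) {A B : C}
    (δ : S.𝔼.Ext B A) : ∃ X : NComplex n A B, X ∈ S.𝔰 δ := by
  obtain ⟨X, hX⟩ := S.isClass δ
  refine ⟨X, hX ▸ ⟨HomotopyEquiv.refl _, ⟨?_, ?_⟩, ⟨?_, ?_⟩⟩⟩ <;> simp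

/-- Exactness of `C(T, D) → 𝔼(T, A) → 𝔼(T, Y₁)` for a conflation `A → Y₁ → ⋯ → Yₙ → D`. -/
lemma NExangulated.exists_pull_eq (S : NExangulated.{w} k C n) (hn : 1 ≤ n) {A D T : C}
    {ρ : S.𝔼.Ext D A} {Y : NComplex n A D} (hY : Y ∈ S.𝔰 ρ) {θ : S.𝔼.Ext T A}
    (hθ : S.𝔼.push Y.dFirst θ = 0) : ∃ c : T ⟶ D, S.𝔼.pull c ρ = θ := by
  obtain ⟨m, rfl⟩ : ∃ m, n = m + 1 := ⟨n - 1, by omega⟩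
  -- `μ` has components `ρ` and `θ`. The first differential of `Y` kills both, so the mapping cone
  -- of a good lift of `biprod.inl` realizes `0` and its last differential has a section `s`.
  have := hasBinaryBiproducts_of_finite_biproducts C
  let μ : S.𝔼.Ext (D ⊞ T) A := S.𝔼.pull biprod.fst ρ + S.𝔼.pull biprod.snd θ
  have hl : S.𝔼.pull biprod.inl μ = ρ := by
    rw [map_add, ← S.𝔼.pull_comp, ← S.𝔼.pull_comp, biprod.inl_fst, biprod.inl_snd, S.𝔼.pull_id,
      S.𝔼.pull_zero, add_zero]
  have hr : S.𝔼.pull biprod.inr μ = θ := by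
    rw [map_add, ← S.𝔼.pull_comp, ← S.𝔼.pull_comp, biprod.inr_fst, biprod.inr_snd, S.𝔼.pull_id,
      S.𝔼.pull_zero, zero_add]
  have hμ : S.𝔼.push Y.dFirst μ = 0 := by
    rw [map_add, S.𝔼.push_pull, S.𝔼.push_pull, hθ, (S.isNExangle ρ Y hY).push_eq_zero, map_zero,
      map_zero, add_zero]
  obtain ⟨Y', hY'⟩ := S.exists_realization μ
  obtain ⟨f, hf, M, ⟨hM⟩, hM'⟩ := S.good_lift μ biprod.inl Y Y' (by rwa [hl]) hY'
  obtain ⟨s, hs⟩ := ((S.isNExangle _ M hM').exact_left_last (D ⊞ T) (𝟙 _)).1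
    (by simp only [hμ, map_zero])
  have hd : M.dLast = hM.p (m + 1) ≫ Y.right.hom ≫ biprod.inl + hM.q (m + 1) ≫ Y'.dLast := by
    have h1 : M.dLast = (M.K.d (m + 1) (m + 2) ≫ hM.q (m + 2)) ≫ Y'.right.hom :=
      (congrArg (M.K.d (m + 1) (m + 2) ≫ ·) hM.q_last.symm).trans (Category.assoc _ _ _).symm
    rw [h1, hM.d_q m le_rfl, Preadditive.add_comp, Category.assoc, Category.assoc]
    exact congrArg (fun x => hM.p (m + 1) ≫ x + hM.q (m + 1) ≫ Y'.dLast) hf.right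
  refine ⟨biprod.inr ≫ s ≫ hM.p (m + 1) ≫ Y.right.hom, ?_⟩
  -- The section writes `biprod.inr` as a map through `biprod.inl` plus a map through `Y'.dLast`.
  -- Pulling `μ` back along it gives `θ` on the left and, since `Y'.dLast` kills `μ`, `pull c ρ` on
  -- the right.
  have hinr : (biprod.inr : T ⟶ D ⊞ T) =
      (biprod.inr ≫ s ≫ hM.p (m + 1) ≫ Y.right.hom) ≫ biprod.inl +
        (biprod.inr ≫ s ≫ hM.q (m + 1)) ≫ Y'.dLast := by
    have h1 : s ≫ M.dLast = 𝟙 _ := hs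
    rw [hd] at h1
    calc (biprod.inr : T ⟶ D ⊞ T) = biprod.inr ≫ 𝟙 _ := (Category.comp_id _).symm
      _ = _ := by rw [← h1]; simp only [Preadditive.comp_add, Category.assoc]
  rw [← hr]
  conv_rhs => rw [hinr, S.𝔼.pull_add, S.𝔼.pull_comp, S.𝔼.pull_comp _ (_ ≫ _), hl,
    (S.isNExangle μ Y' hY').pull_eq_zero, map_zero, add_zero]

/-- Exactness of `C(A, Z) → 𝔼(D, Z) → 𝔼(Yₙ, Z)` for a conflation `A → Y₁ → ⋯ → Yₙ → D`. -/
lemma NExangulated.exists_push_eq (S : NExangulated.{w} k C n) (hn : 1 ≤ n) {A D Z : C}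
    {ρ : S.𝔼.Ext D A} {Y : NComplex n A D} (hY : Y ∈ S.𝔰 ρ) {θ : S.𝔼.Ext D Z}
    (hθ : S.𝔼.pull Y.dLast θ = 0) : ∃ a : A ⟶ Z, S.𝔼.push a ρ = θ := by
  -- Dual argument: the mapping cocone of a good lift of `biprod.fst` realizes `0`, so its first
  -- differential has a retraction `r`.
  have := hasBinaryBiproducts_of_finite_biproducts C
  let μ : S.𝔼.Ext D (A ⊞ Z) := S.𝔼.push biprod.inl ρ + S.𝔼.push biprod.inr θ
  have hl : S.𝔼.push biprod.fst μ = ρ := by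
    rw [map_add, ← S.𝔼.push_comp, ← S.𝔼.push_comp, biprod.inl_fst, biprod.inr_fst, S.𝔼.push_id,
      S.𝔼.push_zero, add_zero]
  have hr : S.𝔼.push biprod.snd μ = θ := by
    rw [map_add, ← S.𝔼.push_comp, ← S.𝔼.push_comp, biprod.inl_snd, biprod.inr_snd, S.𝔼.push_id,
      S.𝔼.push_zero, zero_add]
  have hμ : S.𝔼.pull Y.dLast μ = 0 := by
    rw [map_add, ← S.𝔼.push_pull, ← S.𝔼.push_pull, hθ, (S.isNExangle ρ Y hY).pull_eq_zero,
      map_zero, map_zero, add_zero]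
  obtain ⟨X, hX⟩ := S.exists_realization μ
  obtain ⟨f, hf, N, ⟨hN⟩, hN'⟩ := S.good_lift_op μ biprod.fst X Y hX (by rwa [hl])
  obtain ⟨r, hs⟩ := ((S.isNExangle _ N hN').exact_right_last (A ⊞ Z) (𝟙 _)).1
    (by simp only [hμ, map_zero])
  -- Maps out of the degree-one term are needed, so the injections `j₁`, `j₂` are recovered from the
  -- product property.
  obtain ⟨hlim⟩ := hN.isProd 0 hn
  obtain ⟨j₁, h₁p, h₁q⟩ := BinaryFan.IsLimit.lift' hlim (𝟙 (X.K.X 1)) (0 : _ ⟶ Y.K.X 0)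
  obtain ⟨j₂, h₂p, h₂q⟩ := BinaryFan.IsLimit.lift' hlim (0 : _ ⟶ X.K.X 1) (𝟙 (Y.K.X 0))
  change j₁ ≫ hN.p 1 = _ at h₁p
  change j₁ ≫ hN.q 0 = _ at h₁q
  change j₂ ≫ hN.p 1 = _ at h₂p
  change j₂ ≫ hN.q 0 = _ at h₂q
  have hp0 : N.left.inv ≫ hN.p 0 = X.left.inv := by
    rw [Iso.inv_comp_eq, ← hN.p_zero, Category.assoc, Iso.hom_inv_id, Category.comp_id]
  have hdp : N.dFirst ≫ hN.p 1 = X.dFirst := by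
    have := hN.d_p 0 hn
    rw [NComplex.dFirst, Category.assoc]
    exact (congrArg (N.left.inv ≫ ·) this).trans
      ((Category.assoc _ _ _).symm.trans (congrArg (· ≫ X.K.d 0 1) hp0))
  have hdq : N.dFirst ≫ hN.q 0 = biprod.fst ≫ Y.left.inv := by
    rw [NComplex.dFirst, Category.assoc, hN.d_q_zero, ← Category.assoc, hp0, Iso.inv_comp_eq,
      ← Category.assoc, Iso.eq_comp_inv, hf.left]
  have hd : N.dFirst = X.dFirst ≫ j₁ + biprod.fst ≫ Y.left.inv ≫ j₂ := by
    refine BinaryFan.IsLimit.hom_ext hlim ?_ ?_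
    · change N.dFirst ≫ hN.p 1 = (_ + _) ≫ hN.p 1
      simp [hdp, h₁p, h₂p]
    · change N.dFirst ≫ hN.q 0 = (_ + _) ≫ hN.q 0
      simp [hdq, h₁q, h₂q]
  refine ⟨Y.left.inv ≫ j₂ ≫ r ≫ biprod.snd, ?_⟩
  have hid : X.dFirst ≫ j₁ ≫ r + biprod.fst ≫ Y.left.inv ≫ j₂ ≫ r = 𝟙 _ := by
    rw [← hs, hd]
    simp only [Preadditive.add_comp, Category.assoc]
  have hμ' : S.𝔼.push (Y.left.inv ≫ j₂ ≫ r) ρ = μ := by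
    conv_rhs => rw [← S.𝔼.push_id μ, ← hid, S.𝔼.push_add, S.𝔼.push_comp, S.𝔼.push_comp biprod.fst,
      hl, (S.isNExangle μ X hX).push_eq_zero, map_zero, zero_add]
  rw [← hr, ← hμ', ← S.𝔼.push_comp]
  simp only [Category.assoc]

/-! ### Almost split extensions. -/

variable (S : NExangulated.{w} k C n)

lemma exists_isAlmostSplit {X Y : C} [IsLocalRing (End Y)] (π : X ⟶ Y) [IsSplitEpi π]
    (hY : ∃ (Z : C) (δ : S.𝔼.Ext Y Z), δ ≠ 0)
    (h : ∀ H : Submodule (End X)ᵐᵒᵖ (X ⟶ Y), (∀ f : X ⟶ Y, S.𝔼.ProjTrivial f → f ∈ H) →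
      ∃ (W : C) (α : W ⟶ Y), S.IsDeflation α ∧ IsRightDetermined X α ∧
        Set.range (fun g : X ⟶ W => g ≫ α) = (H : Set (X ⟶ Y))) :
    ∃ (A : C) (ρ : S.𝔼.Ext Y A), IsAlmostSplit S.𝔼 ρ := by
  obtain ⟨Z, δ, hδ⟩ := hY
  -- A projectively trivial split epimorphism onto `Y` would force `δ = 0`.
  obtain ⟨W, α, ⟨A, ρ, K, e, hK, rfl⟩, hdet, him⟩ := h (nonSplitEpi X Y) (by
    rintro f hf ⟨⟨s, hs⟩⟩
    exact hδ (by rw [← S.𝔼.pull_id δ, ← hs, S.𝔼.pull_comp, hf, map_zero]))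
  have hmem : ∀ f : X ⟶ Y, (∃ g, g ≫ e.hom ≫ K.dLast = f) ↔ ¬ IsSplitEpi f := fun f =>
    Set.ext_iff.1 him f
  have hρ := S.isNExangle ρ K hK
  refine ⟨A, ρ, ?_, ?_⟩
  · rintro rfl
    obtain ⟨s, hs⟩ := (hρ.exact_left_last Y (𝟙 Y)).1 (map_zero _)
    have hs : s ≫ K.dLast = 𝟙 Y := hs
    -- If `ρ = 0`, the deflation splits and `π` factors through it, although `π` is a split
    -- epimorphism.
    exact (hmem π).1 ⟨π ≫ s ≫ e.inv, by simp [hs]⟩ inferInstance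
  · intro L g hg
    -- If `g` is not a split epimorphism, neither is `a ≫ g` for any `a : X ⟶ L`; determinacy then
    -- factors `g` through the deflation.
    obtain ⟨t, rfl⟩ := hdet L g fun a => (hmem _).2 (by
      rintro ⟨⟨s, hs⟩⟩
      exact hg ⟨⟨s ≫ a, (Category.assoc _ _ _).trans hs⟩⟩)
    rw [S.𝔼.pull_comp, S.𝔼.pull_comp, hρ.pull_eq_zero, map_zero, map_zero]

variable {S}

/-- Some component of `ρ` along a decomposition of `A` is nonzero, and push-forward commutes with
pull-back. -/
lemma IsAlmostSplit.exists_local {𝔼 : ExtBifunctor.{w} k C} (hKS : IsKrullSchmidt C) {Y A : C}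
    {ρ : 𝔼.Ext Y A} (hρ : IsAlmostSplit 𝔼 ρ) :
    ∃ (Z : C) (ρ' : 𝔼.Ext Y Z), IsLocalRing (End Z) ∧ IsAlmostSplit 𝔼 ρ' := by
  obtain ⟨m, Z, hZ, ⟨e⟩⟩ := hKS A
  obtain ⟨i, hi⟩ : ∃ i, 𝔼.push (e.hom ≫ biproduct.π Z i) ρ ≠ 0 := by
    by_contra! h
    refine hρ.ne_zero ?_
    rw [← 𝔼.push_id ρ, ← sum_comp_eq_id_of_iso e, 𝔼.push_sum]
    exact Finset.sum_eq_zero fun i _ => by rw [𝔼.push_comp, h, map_zero]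
  refine ⟨Z i, _, hZ i, hi, fun g hg => ?_⟩
  rw [← 𝔼.push_pull, hρ.pull_eq_zero g hg, map_zero]

/-- Every nonzero extension of `Y` is pushed to an almost split extension. -/
lemma IsAlmostSplit.exists_push_eq (hn : 1 ≤ n) {Y Z T : C} {ρ : S.𝔼.Ext Y Z}
    (hρ : IsAlmostSplit S.𝔼 ρ) {δ : S.𝔼.Ext Y T} (hδ : δ ≠ 0) :
    ∃ g : T ⟶ Z, S.𝔼.push g δ = ρ := by
  obtain ⟨K, hK⟩ := S.exists_realization δ
  refine S.exists_push_eq hn hK (hρ.pull_eq_zero _ ?_)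
  rintro ⟨⟨s, hs⟩⟩
  exact hδ (by rw [← S.𝔼.pull_id δ, ← hs, S.𝔼.pull_comp, (S.isNExangle δ K hK).pull_eq_zero,
    map_zero])

/-- Otherwise some `c` pushes `push a ρ` back to `ρ`, so `𝟙 Z - a ≫ c` kills `ρ ≠ 0` and is not a
unit; by locality `a ≫ c` is one, and `a` splits. -/
lemma IsAlmostSplit.push_eq_zero (hn : 1 ≤ n) {Y Z Z' : C} [IsLocalRing (End Z)]
    {ρ : S.𝔼.Ext Y Z} (hρ : IsAlmostSplit S.𝔼 ρ) (a : Z ⟶ Z') (ha : ¬ IsSplitMono a) :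
    S.𝔼.push a ρ = 0 := by
  by_contra hne
  obtain ⟨c, hc⟩ := hρ.exists_push_eq hn hne
  rcases IsLocalRing.isUnit_or_isUnit_of_add_one (R := End Z) (a := (a ≫ c : Z ⟶ Z))
    (b := (𝟙 Z - a ≫ c : Z ⟶ Z)) (add_sub_cancel _ _) with hu | hu
  · have : IsIso (a ≫ c) := (isUnit_iff_isIso _).1 hu
    exact ha ⟨⟨c ≫ inv (a ≫ c), by rw [← Category.assoc, IsIso.hom_inv_id]⟩⟩
  · have : IsIso (𝟙 Z - a ≫ c) := (isUnit_iff_isIso _).1 hu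
    refine hρ.ne_zero ?_
    rw [← S.𝔼.push_id ρ, ← IsIso.hom_inv_id (𝟙 Z - a ≫ c), S.𝔼.push_comp, S.𝔼.push_sub,
      S.𝔼.push_id, S.𝔼.push_comp, hc, sub_self, map_zero]

/-- Every nonzero extension by `Z` is pulled back to an almost split extension. -/
lemma IsAlmostSplit.exists_pull_eq (hn : 1 ≤ n) {Y Z W : C} [IsLocalRing (End Z)]
    {ρ : S.𝔼.Ext Y Z} (hρ : IsAlmostSplit S.𝔼 ρ) {ξ : S.𝔼.Ext W Z} (hξ : ξ ≠ 0) :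
    ∃ b : Y ⟶ W, S.𝔼.pull b ξ = ρ := by
  obtain ⟨K, hK⟩ := S.exists_realization ξ
  refine S.exists_pull_eq hn hK (hρ.push_eq_zero hn _ ?_)
  rintro ⟨⟨r, hr⟩⟩
  exact hξ (by rw [← S.𝔼.push_id ξ, ← hr, S.𝔼.push_comp, (S.isNExangle ξ K hK).push_eq_zero,
    map_zero])

/-- Nonzero extensions of `Y` push to `ρ`, giving nondegeneracy and thus surjectivity. A nonzero
`push g δ` pulls back to `ρ`, so `g` is detected by `φ` already on extensions of `Y`. -/
lemma IsAlmostSplit.isUniversal [IsArtinianRing k] {I : Type uk} [AddCommGroup I] [Module k I]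
    (hI : IsMinimalInjectiveCogenerator k I) (hfin : S.ExtFinite) (hn : 1 ≤ n) {Y Z : C}
    [IsLocalRing (End Z)] {ρ : S.𝔼.Ext Y Z} (hρ : IsAlmostSplit S.𝔼 ρ)
    {φ : S.𝔼.Ext Y Z →ₗ[k] I} (hφ : φ ρ ≠ 0) : S.𝔼.IsUniversal φ where
  surjective T := by
    have := hfin Y T
    refine hI.surjective_of_nondegenerate _ fun δ hδ => ?_
    by_contra hne
    obtain ⟨g, rfl⟩ := hρ.exists_push_eq hn hne
    exact hφ (hδ g)
  injTrivial {T} g hg W δ := by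
    by_contra hne
    obtain ⟨b, hb⟩ := hρ.exists_pull_eq hn hne
    refine hφ ?_
    rw [← hb, ← S.𝔼.push_pull]
    exact LinearMap.congr_fun hg (S.𝔼.pull b δ)

end

end HigherExact

end

theorem proposition4p16 {k : Type uk} [CommRing k] [IsArtinianRing k]
    (I : Type uk) [AddCommGroup I] [Module k I]
    (hI : HigherExact.IsMinimalInjectiveCogenerator k I)
    {C : Type u} [Category.{v} C] [Preadditive C] [Linear k C] [HasFiniteBiproducts C]
    (n : ℕ) (hn : 1 ≤ n) (S : HigherExact.NExangulated.{w} k C n)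
    (hfin : S.ExtFinite) (hKS : HigherExact.IsKrullSchmidt C) (hWIC : S.WIC)
    (X : C)
    (h : ∀ (Y : C) (H : Submodule (End X)ᵐᵒᵖ (X ⟶ Y)),
      (∀ f : X ⟶ Y, S.𝔼.ProjTrivial f → f ∈ H) →
      ∃ (W : C) (α : W ⟶ Y), S.IsDeflation α ∧ HigherExact.IsRightDetermined X α ∧
        Set.range (fun g : X ⟶ W => g ≫ α) = (H : Set (X ⟶ Y))) :
    S.MemCr I X := by
  obtain ⟨m, Y, hY, ⟨e⟩⟩ := hKS X
  obtain ⟨Z, φ, hφ⟩ := HigherExact.ExtBifunctor.exists_isUniversal_biproduct (𝔼 := S.𝔼) (I := I) e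
    fun i => by
      -- When `𝔼(Y i, -)` vanishes there is no almost split extension, and the zero object
      -- represents the zero functor.
      by_cases hproj : ∀ (Z : C) (δ : S.𝔼.Ext (Y i) Z), δ = 0
      · exact ⟨_, _, HigherExact.ExtBifunctor.isUniversal_zero hproj⟩
      · push Not at hproj
        have := hY i
        obtain ⟨A, ρ, hρ⟩ := HigherExact.exists_isAlmostSplit S (e.hom ≫ biproduct.π Y i) hproj
          (h (Y i))
        obtain ⟨Z, ρ', _, hρ'⟩ := hρ.exists_local hKS
        have := hfin (Y i) Z
        obtain ⟨φ, hφ⟩ := hI.exists_ne_zero hρ'.ne_zero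
        exact ⟨Z, φ, hρ'.isUniversal hI hfin hn hφ⟩
  exact hφ.isLinearRepresentable
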